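/- Let $p$ be a real polynomial of degree $m$. For each $n\ge 1$, let $a^{(n)}_1,\dots,a^{(n)}_n,\ b^{(n)}_1,\dots,b^{(n)}_{n-1}$ be independent real random variables on a probability space (which may depend on $n$), with $b^{(n)}_i>0$ almost surely, and let $J_n$ be the random Jacobi matrix, i.e. the symmetric tridiagonal $n\times n$ matrix with $J_n(i,i)=a^{(n)}_i$ and $J_n(i,i+1)=J_n(i+1,i)=b^{(n)}_i$. Put $$S_n=\operatorname{Tr}\,p(J_n)=\sum_{j=1}^n p(J_n)(j,j).$$ Let $\mathcal F_0$ be the trivial $\sigma$-algebra and, for $1\le k\le n$, let $\mathcal F_k=\sigma(a^{(n)}_i,b^{(n)}_i: i\le k)$ (the entry $b^{(n)}_n$, which does not exist, being omitted). An admissible path of length $r\ge 0$ is a sequence $w=(i_0,i_1,\dots,i_r)$ in $\{1,\dots,n\}$ with $i_r=i_0$ and $|i_{l+1}-i_l|\le 1$ for $0\le l<r$; put $\xi_w=\prod_{l=0}^{r-1}J_n(i_l,i_{l+1})$. Let $\mathcal Q_m(n)$ be the set of admissible paths of length at most $m$. Assume that $\xi_w$ is integrable for all $n$ and all $w\in\mathcal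 Q_m(n)$, and put $$\Delta_k(\xi_w)=\mathbb E[\xi_w\mid\mathcal F_k]-\mathbb E[\xi_w\mid\mathcal F_{k-1}],\qquad 1\le k\le n.$$ Suppose that there are positive real numbers $v_n$ and constants $\sigma_p^2\ge 0$, $C>0$, $\delta>0$ not depending on $n$ such that (i) $v_n^2\operatorname{Var}[S_n]\to\sigma_p^2$ as $n\to\infty$; (ii) $v_n^4\,\mathbb E[\Delta_k(\xi_w)^4]\le \dfrac{C}{n^{1+\delta}}$ for all $n\ge1$, all $w\in\mathcal Q_m(n)$ and all $k=1,\dots,n$. Then, as $n\to\infty$, $$v_n\big(S_n-\mathbb E[S_n]\big)\ \xrightarrow{\ d\ }\ \mathcal N(0,\sigma_p^2),$$ where $\mathcal N(0,0)$ denotes the point mass at $0$. -/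

import Mathlib

open MeasureTheory ProbabilityTheory Filter
open scoped NNReal Topology

namespace RandomJacobi

/-- The Jacobi (symmetric tridiagonal) matrix of size `n` with diagonal `a` and off-diagonal `b`.
Indices start at `0`: the entry `a i` here is the entry usually written with index `i + 1`,
and `b i` sits at the positions `(i, i + 1)` and `(i + 1, i)`. -/
def jacobi {n : ℕ} (a : Fin n → ℝ) (b : Fin (n - 1) → ℝ) : Matrix (Fin n) (Fin n) ℝ :=
  Matrix.of fun i j =>
    if i = j then a i
    else if h : (i : ℕ) + 1 = j then b ⟨i, by omega⟩
    else if h : (j : ℕ) + 1 = i then b ⟨j, by omega⟩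
    else 0

/-- An admissible path `(w 0, …, w r)` of length `r`: a closed path in the `n` indices
all of whose steps have size at most one. -/
def IsAdmissible {n r : ℕ} (w : Fin (r + 1) → Fin n) : Prop :=
  w (Fin.last r) = w 0 ∧ ∀ l : Fin r, |((w l.succ : ℕ) : ℤ) - ((w l.castSucc : ℕ) : ℤ)| ≤ 1

section Random

variable {Ω : Type*} {n : ℕ}

/-- The random matrix `J` with the random entries `a` and `b`. -/
def randomJacobi (a : Fin n → Ω → ℝ) (b : Fin (n - 1) → Ω → ℝ) (ω : Ω) :
    Matrix (Fin n) (Fin n) ℝ :=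
  jacobi (fun i => a i ω) (fun i => b i ω)

/-- The linear statistic `Tr p(J)`. -/
noncomputable def linStat (a : Fin n → Ω → ℝ) (b : Fin (n - 1) → Ω → ℝ) (p : Polynomial ℝ)
    (ω : Ω) : ℝ :=
  (Polynomial.aeval (randomJacobi a b ω) p).trace

/-- The path variable `ξ_w`, the product over the steps of `w` of the entries of `J`. -/
def pathVar (a : Fin n → Ω → ℝ) (b : Fin (n - 1) → Ω → ℝ) {r : ℕ} (w : Fin (r + 1) → Fin n)
    (ω : Ω) : ℝ :=
  ∏ l : Fin r, randomJacobi a b ω (w l.castSucc) (w l.succ)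

/-- The σ-algebra generated by the first `k` diagonal entries and the first `k` off-diagonal
entries (by all off-diagonal ones if `k = n`); it is trivial for `k = 0`. -/
@[reducible] def entryFiltration (a : Fin n → Ω → ℝ) (b : Fin (n - 1) → Ω → ℝ) (k : ℕ) :
    MeasurableSpace Ω :=
  (⨆ (i : Fin n) (_ : (i : ℕ) < k), MeasurableSpace.comap (a i) inferInstance) ⊔
    ⨆ (i : Fin (n - 1)) (_ : (i : ℕ) < k), MeasurableSpace.comap (b i) inferInstance

/-- The martingale increment `Δ_k(ξ) = E[ξ | F_k] - E[ξ | F_{k-1}]`, for `k ≥ 1`. -/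
noncomputable def increment [MeasurableSpace Ω] (μ : Measure Ω)
    (a : Fin n → Ω → ℝ) (b : Fin (n - 1) → Ω → ℝ) (k : ℕ) (ξ : Ω → ℝ) (ω : Ω) : ℝ :=
  (μ[ξ | entryFiltration a b k]) ω - (μ[ξ | entryFiltration a b (k - 1)]) ω

end Random

end RandomJacobi

/-!
Write `E[· | F_k]` for the conditional expectations along the filtration of the entries. The centred
statistic `S - E S` telescopes into the martingale differences `E[S | F_{j+1}] - E[S | F_j]`,
`j < n`. Expanding the trace over closed paths turns `S` into a fixed linear combination of path
variables `ξ_w`, of lengths at most `d = deg p`. Since the entries are independent, `ξ_w` contributes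
to the difference of index `j` only if `w` visits indices on both sides of `j`
(`increment_pathVar_ae_eq_zero`), hence only if `w` stays within distance `d` of `j`. There are
boundedly many such paths (`card_pathsNear_le`), so the moment hypothesis on the increments of the
`ξ_w` gives fourth moments of the rescaled differences of order `n ^ (-(1 + δ))`.

The same locality makes the `j`-th difference a function of the entries at positions `≥ j - d` only
(`condExp_entryFiltration_eq`), so its conditional variance given `F_{j-d}` is a constant
(`condExp_increment_linStat_sq`). For such martingale differences `X_j` the characteristic functions
of the partial sums can be compared step by step: with `σ_j² = E X_j²` and partial sums `S_j`,
`E exp(it S_{j+1})` differs from `exp(-t² σ_j² / 2) E exp(it S_j)` by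
`-t²/2 E[exp(it S_j) (X_j² - σ_j²)]` and third-order terms, the first-order term vanishing by the
martingale property. In the quadratic term, `exp(it S_j)` may be replaced by `exp(it S_{j-d})`, which
makes it vanish, at the cost of `|t|³/2 E[|S_j - S_{j-d}| |X_j² - σ_j²|]`, again of third order
(`norm_integral_cexp_add_sub_le`). Third-order quantities are bounded by `ε` times second moments plus
`ε⁻¹` times fourth moments. Second moments sum to the variance by orthogonality, fourth moments
sum to `O(n ^ (-δ))`, and a suitable `ε → 0` yields convergence of the characteristic functions to
that of the normal law (`norm_integral_cexp_sum_sub_le`,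
`tendstoInDistribution_of_martingale_differences`), hence convergence in distribution by Lévy's
theorem.
-/

namespace RandomJacobi

/-! ### Taylor estimates and conditional expectations -/

section

theorem norm_cexp_mul_I_sub_taylor_le (x : ℝ) :
    ‖Complex.exp (x * Complex.I) - 1 - x * Complex.I + (x : ℂ) ^ 2 / 2‖ ≤ 4 * |x| ^ 3 := by
  have hsum : Complex.exp (x * Complex.I) - 1 - x * Complex.I + (x : ℂ) ^ 2 / 2 =
      Complex.exp (x * Complex.I) -
        ∑ m ∈ Finset.range 3, ((x : ℂ) * Complex.I) ^ m / (m.factorial : ℂ) := by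
    simp [Finset.sum_range_succ, mul_pow, Complex.I_sq, Nat.factorial]
    ring
  have hnx : ‖(x : ℂ) * Complex.I‖ = |x| := by simp
  rcases le_total |x| 1 with hx | hx
  · rw [hsum]
    refine (Complex.exp_bound (by rwa [hnx]) (by norm_num)).trans ?_
    rw [hnx, mul_comm]
    gcongr
    norm_num [Nat.factorial]
  · have h1 : ‖Complex.exp (x * Complex.I)‖ = 1 := Complex.norm_exp_ofReal_mul_I x
    have h2 : |x| ≤ |x| ^ 3 := le_self_pow₀ hx (by norm_num)
    have h3 : |x| ^ 2 ≤ |x| ^ 3 := pow_le_pow_right₀ hx (by norm_num)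
    calc _ ≤ ‖Complex.exp (x * Complex.I)‖ + ‖(1 : ℂ)‖ + ‖(x : ℂ) * Complex.I‖
          + ‖(x : ℂ) ^ 2 / 2‖ :=
        (norm_add_le _ _).trans (add_le_add_left
          ((norm_sub_le _ _).trans (add_le_add_left (norm_sub_le _ _) _)) _)
      _ = 1 + 1 + |x| + |x| ^ 2 / 2 := by rw [h1, hnx]; simp
      _ ≤ _ := by linarith

theorem abs_exp_neg_sub_one_add_le {u : ℝ} (hu : 0 ≤ u) : |Real.exp (-u) - (1 - u)| ≤ u ^ 2 := by
  rcases le_total u 1 with h | h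
  · have := Real.abs_exp_sub_one_sub_id_le (x := -u) (by rwa [abs_neg, abs_of_nonneg hu])
    calc _ = |Real.exp (-u) - 1 - -u| := by ring_nf
      _ ≤ _ := this
      _ = _ := by ring
  · have h1 : Real.exp (-u) ≤ 1 := Real.exp_le_one_iff.2 (by linarith)
    have h2 := Real.exp_pos (-u)
    rw [abs_of_nonneg (by linarith)]
    nlinarith

variable {Ω : Type*} {m m₀ : MeasurableSpace Ω} {μ : Measure Ω}

/-- A bounded `m`-measurable complex factor annihilates every variable with vanishing conditional
expectation given `m`. -/
theorem integral_mul_ofReal_eq_zero_of_condExp [IsFiniteMeasure μ] (hm : m ≤ m₀)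
    {Z : Ω → ℂ} {Y : Ω → ℝ}
    (hZ : StronglyMeasurable[m] Z) {c : ℝ} (hZc : ∀ ω, ‖Z ω‖ ≤ c) (hY : Integrable Y μ)
    (h0 : μ[Y | m] =ᵐ[μ] 0) : ∫ ω, Z ω * (Y ω : ℂ) ∂μ = 0 := by
  let B : ℂ →L[ℝ] ℝ →L[ℝ] ℂ := (ContinuousLinearMap.lsmul ℝ ℝ : ℝ →L[ℝ] ℂ →L[ℝ] ℂ).flip
  have hB : (fun ω => Z ω * (Y ω : ℂ)) = fun ω => B (Z ω) (Y ω) := by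
    ext ω
    simp [B, mul_comm]
  have h := condExp_stronglyMeasurable_bilin_of_bound B hm hZ hY c (ae_of_all _ hZc)
  rw [hB, ← integral_condExp hm, integral_congr_ae h]
  refine integral_eq_zero_of_ae ?_
  filter_upwards [h0] with ω hω
  simp [hω]

/-- Conditioning on extra information `m₂` that is independent of everything else involved
does not change a conditional expectation. -/
theorem condExp_sup_of_indep [IsProbabilityMeasure μ] {m₁ m₂ m₃ : MeasurableSpace Ω}
    (h13 : m₁ ≤ m₃) (h2 : m₂ ≤ m₀) (h3 : m₃ ≤ m₀) {f : Ω → ℝ} (hf : Integrable f μ)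
    (hfm : StronglyMeasurable[m₃] f) (hind : Indep m₃ m₂ μ) :
    μ[f | m₁ ⊔ m₂] =ᵐ[μ] μ[f | m₁] := by
  have h1 : m₁ ≤ m₀ := h13.trans h3
  have h12 : m₁ ⊔ m₂ ≤ m₀ := sup_le h1 h2
  -- integrals of `m₃`-measurable functions factor over sets `A ∩ B` with `A ∈ m₁`, `B ∈ m₂`
  have key : ∀ g : Ω → ℝ, Integrable g μ → StronglyMeasurable[m₃] g → ∀ A B,
      MeasurableSet[m₁] A → MeasurableSet[m₂] B →
      ∫ ω in A ∩ B, g ω ∂μ = μ.real B * ∫ ω in A, g ω ∂μ := by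
    intro g hg hgm A B hA hB
    rw [Set.inter_comm, ← setIntegral_indicator (h1 _ hA),
      ← setIntegral_condExp h2 (hg.indicator (h1 _ hA)) hB,
      setIntegral_congr_ae (h2 _ hB) ((condExp_indep_eq h3 h2
        (hgm.indicator (h13 _ hA)) hind).mono fun _ h _ => h),
      setIntegral_const, integral_indicator (h1 _ hA), smul_eq_mul]
  have hmeas : StronglyMeasurable[m₁ ⊔ m₂] (μ[f | m₁]) :=
    stronglyMeasurable_condExp.mono le_sup_left
  symm
  refine ae_eq_condExp_of_forall_setIntegral_eq h12 hf
    (fun s _ _ => integrable_condExp.integrableOn) (fun s hs _ => ?_)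
    hmeas.aestronglyMeasurable
  have hgen : m₁ ⊔ m₂ = MeasurableSpace.generateFrom
      (Set.image2 (· ∩ ·) {s | MeasurableSet[m₁] s} {s | MeasurableSet[m₂] s}) := by
    apply le_antisymm
    · refine sup_le (fun s hs => ?_) (fun s hs => ?_)
      · exact MeasurableSpace.measurableSet_generateFrom
          ⟨s, hs, Set.univ, @MeasurableSet.univ _ m₂, by simp⟩
      · exact MeasurableSpace.measurableSet_generateFrom
          ⟨Set.univ, @MeasurableSet.univ _ m₁, s, hs, by simp⟩
    · refine MeasurableSpace.generateFrom_le ?_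
      rintro _ ⟨A, hA, B, hB, rfl⟩
      exact @MeasurableSet.inter _ (m₁ ⊔ m₂) _ _ ((le_sup_left : m₁ ≤ m₁ ⊔ m₂) _ hA)
        ((le_sup_right : m₂ ≤ m₁ ⊔ m₂) _ hB)
  have hpi : IsPiSystem
      (Set.image2 (· ∩ ·) {s | MeasurableSet[m₁] s} {s | MeasurableSet[m₂] s}) := by
    rintro _ ⟨A, hA, B, hB, rfl⟩ _ ⟨A', hA', B', hB', rfl⟩ _
    exact ⟨A ∩ A', @MeasurableSet.inter _ m₁ _ _ hA hA', B ∩ B',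
      @MeasurableSet.inter _ m₂ _ _ hB hB', Set.inter_inter_inter_comm _ _ _ _⟩
  induction s, hs using MeasurableSpace.induction_on_inter hgen hpi with
  | empty => simp
  | basic s hs =>
    obtain ⟨A, hA, B, hB, rfl⟩ := hs
    simp only
    rw [key _ integrable_condExp (stronglyMeasurable_condExp.mono h13) A B hA hB,
      key f hf hfm A B hA hB, setIntegral_condExp h1 hf hA]
  | compl s hs ih =>
    rw [setIntegral_compl (h12 _ hs) integrable_condExp, setIntegral_compl (h12 _ hs) hf,
      ih (measure_lt_top _ _), integral_condExp h1]
  | iUnion s hd hs ih =>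
    rw [integral_iUnion (fun i => h12 _ (hs i)) hd integrable_condExp.integrableOn,
      integral_iUnion (fun i => h12 _ (hs i)) hd hf.integrableOn]
    exact tsum_congr fun i => ih i (measure_lt_top _ _)

end

/-! ### One step of the characteristic function comparison -/

section

variable {Ω : Type*} {m₀ : MeasurableSpace Ω} {μ : Measure Ω}

theorem integrable_pow_four_of_memLp {X : Ω → ℝ} (hX : MemLp X 4 μ) :
    Integrable (fun ω => X ω ^ 4) μ := by
  have h := hX.integrable_norm_pow (p := 4) (by norm_num)
  refine h.congr (ae_of_all _ fun ω => ?_)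
  simp only [Real.norm_eq_abs]
  exact Even.pow_abs (by decide) _

theorem norm_cexp_mul_I_sub_cexp_mul_I_le (x y : ℝ) :
    ‖Complex.exp (x * Complex.I) - Complex.exp (y * Complex.I)‖ ≤ |x - y| := by
  have h : Complex.exp (x * Complex.I) - Complex.exp (y * Complex.I) =
      Complex.exp (y * Complex.I) * (Complex.exp (Complex.I * ((x - y : ℝ) : ℂ)) - 1) := by
    rw [mul_sub, ← Complex.exp_add, mul_one]
    congr 2
    push_cast
    ring
  rw [h, norm_mul, Complex.norm_exp_ofReal_mul_I, one_mul]
  exact Real.norm_exp_I_mul_ofReal_sub_one_le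

theorem two_mul_abs_mul_le {ε : ℝ} (hε : 0 < ε) (x y : ℝ) :
    2 * (|x| * |y|) ≤ ε * x ^ 2 + y ^ 2 / ε := by
  have h : 0 ≤ (ε * |x| - |y|) ^ 2 / ε := by positivity
  have h' : (ε * |x| - |y|) ^ 2 / ε = ε * x ^ 2 + y ^ 2 / ε - 2 * (|x| * |y|) := by
    rw [← sq_abs x, ← sq_abs y]
    field_simp
    ring
  linarith

/-- One step of the comparison of characteristic functions. Here `A` is the current partial sum, `B`
an earlier one, `X` the next martingale difference. That the conditional variance of `X` is constant
is required only given the smaller σ-algebra `𝒢` of `B`; replacing `A` by `B` in the quadratic term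
costs the summand with `(A - B) ^ 2`. -/
theorem norm_integral_cexp_add_sub_le [IsProbabilityMeasure μ] {𝒢 ℱ : MeasurableSpace Ω}
    (h𝒢 : 𝒢 ≤ ℱ) (hℱ : ℱ ≤ m₀) {A B X : Ω → ℝ} (hA : StronglyMeasurable[ℱ] A)
    (hB : StronglyMeasurable[𝒢] B) (hX : MemLp X 4 μ) (hAB : MemLp (fun ω => A ω - B ω) 2 μ)
    (h1 : μ[X | ℱ] =ᵐ[μ] 0)
    (h2 : μ[fun ω => X ω ^ 2 | 𝒢] =ᵐ[μ] fun _ => ∫ ω, X ω ^ 2 ∂μ)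
    (t : ℝ) {ε β : ℝ} (hε : 0 < ε) (hβ : ∫ ω, X ω ^ 4 ∂μ ≤ β) :
    ‖∫ ω, Complex.exp ((t * (A ω + X ω) : ℝ) * Complex.I) ∂μ -
        (Real.exp (-(t ^ 2 * (∫ ω, X ω ^ 2 ∂μ) / 2)) : ℂ) *
          ∫ ω, Complex.exp ((t * A ω : ℝ) * Complex.I) ∂μ‖ ≤
      2 * |t| ^ 3 * (ε * ∫ ω, X ω ^ 2 ∂μ + β / ε) +
        |t| ^ 3 / 4 * (ε * ∫ ω, (A ω - B ω) ^ 2 ∂μ + β / ε) + t ^ 4 / 4 * β := by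
  set v : ℝ := ∫ ω, X ω ^ 2 ∂μ with hv
  set u : ℝ := t ^ 2 * v / 2 with hu
  have hv0 : 0 ≤ v := integral_nonneg fun ω => sq_nonneg _
  have hu0 : 0 ≤ u := by positivity
  have hX4 := integrable_pow_four_of_memLp hX
  have hX2 : Integrable (fun ω => X ω ^ 2) μ :=
    (hX.mono_exponent (q := 4) (p := 2) (by norm_num)).integrable_sq
  have hX1 : Integrable X μ := hX.integrable (by norm_num)
  have hD2 : Integrable (fun ω => (A ω - B ω) ^ 2) μ := hAB.integrable_sq
  have hYint : Integrable (fun ω => X ω ^ 2 - v) μ := hX2.sub (integrable_const v)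
  have hY2 : Integrable (fun ω => (X ω ^ 2 - v) ^ 2) μ := by
    have : (fun ω => (X ω ^ 2 - v) ^ 2) = fun ω => X ω ^ 4 - 2 * v * X ω ^ 2 + v ^ 2 := by
      ext ω; ring
    rw [this]
    exact (hX4.sub (hX2.const_mul _)).add (integrable_const _)
  have hY2val : ∫ ω, (X ω ^ 2 - v) ^ 2 ∂μ = ∫ ω, X ω ^ 4 ∂μ - v ^ 2 := by
    have : (fun ω => (X ω ^ 2 - v) ^ 2) = fun ω => X ω ^ 4 - 2 * v * X ω ^ 2 + v ^ 2 := by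
      ext ω; ring
    rw [this, integral_add (hX4.sub' (hX2.const_mul _)) (integrable_const _),
      integral_sub hX4 (hX2.const_mul _), integral_const_mul, integral_const]
    simp [← hv]
    ring
  have hvβ : v ^ 2 ≤ β := by
    have : 0 ≤ ∫ ω, (X ω ^ 2 - v) ^ 2 ∂μ := integral_nonneg fun ω => sq_nonneg _
    linarith
  have hY2β : ∫ ω, (X ω ^ 2 - v) ^ 2 ∂μ ≤ β := by nlinarith [sq_nonneg v]
  have hcont : Continuous fun x : ℝ => Complex.exp ((t * x : ℝ) * Complex.I) := by fun_prop
  have hZ0 : StronglyMeasurable[ℱ] fun ω => Complex.exp ((t * A ω : ℝ) * Complex.I) :=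
    hcont.comp_stronglyMeasurable hA
  have hZ1 : StronglyMeasurable[𝒢] fun ω => Complex.exp ((t * B ω : ℝ) * Complex.I) :=
    hcont.comp_stronglyMeasurable hB
  have hn (x : ℝ) : ‖Complex.exp (x * Complex.I)‖ ≤ 1 := (Complex.norm_exp_ofReal_mul_I x).le
  have hE0 : Integrable (fun ω => Complex.exp ((t * A ω : ℝ) * Complex.I)) μ :=
    .of_bound (hZ0.mono hℱ).aestronglyMeasurable 1 (ae_of_all _ fun ω => hn _)
  have hE1 : Integrable (fun ω => Complex.exp ((t * (A ω + X ω) : ℝ) * Complex.I)) μ :=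
    .of_bound (hcont.comp_aestronglyMeasurable
      ((hA.mono hℱ).aestronglyMeasurable.add hX.1)) 1 (ae_of_all _ fun ω => hn _)
  have hI0 : Integrable (fun ω => Complex.exp ((t * A ω : ℝ) * Complex.I) * (X ω : ℂ)) μ :=
    hX1.ofReal.bdd_mul (c := 1) (hZ0.mono hℱ).aestronglyMeasurable (ae_of_all _ fun ω => hn _)
  have hI1 : Integrable
      (fun ω => Complex.exp ((t * B ω : ℝ) * Complex.I) * ((X ω ^ 2 - v : ℝ) : ℂ)) μ :=
    hYint.ofReal.bdd_mul (c := 1) (hZ1.mono (h𝒢.trans hℱ)).aestronglyMeasurable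
      (ae_of_all _ fun ω => hn _)
  have hz0 : ∫ ω, Complex.exp ((t * A ω : ℝ) * Complex.I) * (X ω : ℂ) ∂μ = 0 :=
    integral_mul_ofReal_eq_zero_of_condExp hℱ hZ0 (fun ω => hn _) hX1 h1
  have hz1 : ∫ ω, Complex.exp ((t * B ω : ℝ) * Complex.I) * ((X ω ^ 2 - v : ℝ) : ℂ) ∂μ = 0 := by
    refine integral_mul_ofReal_eq_zero_of_condExp (h𝒢.trans hℱ) hZ1 (fun ω => hn _) hYint ?_
    have h3 := condExp_sub hX2 (integrable_const v) 𝒢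
    filter_upwards [h2, h3] with ω hω hω3
    rw [condExp_const (h𝒢.trans hℱ)] at hω3
    change (μ[(fun ω => X ω ^ 2) - fun _ => v | 𝒢]) ω = 0
    rw [hω3, Pi.sub_apply, hω, sub_self]
  -- the integrand minus its first-order and (decoupled) second-order parts, which integrate to `0`
  set G : Ω → ℂ := fun ω => Complex.exp ((t * (A ω + X ω) : ℝ) * Complex.I) -
    (Real.exp (-u) : ℂ) * Complex.exp ((t * A ω : ℝ) * Complex.I) -
    (t * Complex.I) * (Complex.exp ((t * A ω : ℝ) * Complex.I) * (X ω : ℂ)) +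
    ((t : ℂ) ^ 2 / 2) * (Complex.exp ((t * B ω : ℝ) * Complex.I) * ((X ω ^ 2 - v : ℝ) : ℂ)) with hG
  have hGint : ∫ ω, G ω ∂μ = ∫ ω, Complex.exp ((t * (A ω + X ω) : ℝ) * Complex.I) ∂μ -
      (Real.exp (-u) : ℂ) * ∫ ω, Complex.exp ((t * A ω : ℝ) * Complex.I) ∂μ := by
    simp only [hG]
    rw [integral_add ((hE1.sub' (hE0.const_mul _)).sub' (hI0.const_mul _)) (hI1.const_mul _),
      integral_sub (hE1.sub' (hE0.const_mul _)) (hI0.const_mul _),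
      integral_sub hE1 (hE0.const_mul _), integral_const_mul, integral_const_mul,
      integral_const_mul, hz0, hz1]
    ring
  have hbound (ω : Ω) : ‖G ω‖ ≤ 2 * |t| ^ 3 * (ε * X ω ^ 2 + X ω ^ 4 / ε) +
      |t| ^ 3 / 4 * (ε * (A ω - B ω) ^ 2 + (X ω ^ 2 - v) ^ 2 / ε) + t ^ 4 / 4 * β := by
    have hGω : G ω = Complex.exp ((t * A ω : ℝ) * Complex.I) *
          (Complex.exp ((t * X ω : ℝ) * Complex.I) - 1 - ((t * X ω : ℝ) : ℂ) * Complex.I +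
            ((t * X ω : ℝ) : ℂ) ^ 2 / 2) -
        ((t ^ 2 / 2 * (X ω ^ 2 - v) : ℝ) : ℂ) * (Complex.exp ((t * A ω : ℝ) * Complex.I) -
          Complex.exp ((t * B ω : ℝ) * Complex.I)) -
        ((Real.exp (-u) - (1 - u) : ℝ) : ℂ) * Complex.exp ((t * A ω : ℝ) * Complex.I) := by
      have : Complex.exp ((t * (A ω + X ω) : ℝ) * Complex.I) =
          Complex.exp ((t * A ω : ℝ) * Complex.I) * Complex.exp ((t * X ω : ℝ) * Complex.I) := by
        rw [← Complex.exp_add]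
        congr 1
        push_cast
        ring
      simp only [hG, this, hu]
      push_cast
      ring
    have e1 := norm_cexp_mul_I_sub_taylor_le (t * X ω)
    have e2 := norm_cexp_mul_I_sub_cexp_mul_I_le (t * A ω) (t * B ω)
    have e3 := abs_exp_neg_sub_one_add_le hu0
    have hn' (x : ℝ) : ‖Complex.exp (x * Complex.I)‖ = 1 := Complex.norm_exp_ofReal_mul_I x
    have a1 : 4 * |t * X ω| ^ 3 ≤ 2 * |t| ^ 3 * (ε * X ω ^ 2 + X ω ^ 4 / ε) := by
      have := two_mul_abs_mul_le hε (X ω) (X ω ^ 2)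
      rw [abs_of_nonneg (sq_nonneg (X ω)), ← sq_abs (X ω), ← pow_succ', sq_abs, ← pow_mul] at this
      rw [abs_mul, mul_pow]
      calc 4 * (|t| ^ 3 * |X ω| ^ 3) = 2 * |t| ^ 3 * (2 * |X ω| ^ 3) := by ring
        _ ≤ _ := by gcongr
    have a2 : t ^ 2 / 2 * |X ω ^ 2 - v| * |t * A ω - t * B ω| ≤
        |t| ^ 3 / 4 * (ε * (A ω - B ω) ^ 2 + (X ω ^ 2 - v) ^ 2 / ε) := by
      rw [← mul_sub, abs_mul, ← sq_abs t]
      calc |t| ^ 2 / 2 * |X ω ^ 2 - v| * (|t| * |A ω - B ω|)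
          = |t| ^ 3 / 4 * (2 * (|A ω - B ω| * |X ω ^ 2 - v|)) := by ring
        _ ≤ _ := by gcongr; exact two_mul_abs_mul_le hε _ _
    have a3 : u ^ 2 ≤ t ^ 4 / 4 * β := by
      calc u ^ 2 = t ^ 4 / 4 * v ^ 2 := by rw [hu]; ring
        _ ≤ _ := by gcongr
    rw [hGω]
    refine (norm_sub_le _ _).trans (add_le_add ((norm_sub_le _ _).trans (add_le_add ?_ ?_)) ?_)
    · rw [norm_mul, hn', one_mul]
      exact e1.trans a1
    · rw [norm_mul, Complex.norm_real, Real.norm_eq_abs, abs_mul,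
        abs_of_nonneg (by positivity : 0 ≤ t ^ 2 / 2)]
      exact (mul_le_mul_of_nonneg_left e2 (by positivity)).trans a2
    · rw [norm_mul, hn', mul_one, Complex.norm_real, Real.norm_eq_abs]
      exact e3.trans a3
  have i1 : Integrable (fun ω => 2 * |t| ^ 3 * (ε * X ω ^ 2 + X ω ^ 4 / ε)) μ :=
    ((hX2.const_mul ε).add (hX4.div_const ε)).const_mul _
  have i2 : Integrable
      (fun ω => |t| ^ 3 / 4 * (ε * (A ω - B ω) ^ 2 + (X ω ^ 2 - v) ^ 2 / ε)) μ :=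
    ((hD2.const_mul ε).add (hY2.div_const ε)).const_mul _
  rw [← hGint]
  refine (norm_integral_le_of_norm_le ((i1.add i2).add (integrable_const _))
    (ae_of_all _ hbound)).trans ?_
  simp only [Pi.add_apply]
  rw [integral_add (i1.fun_add i2) (integrable_const _), integral_add i1 i2, integral_const_mul,
    integral_const_mul, integral_add (hX2.const_mul ε) (hX4.div_const ε),
    integral_add (hD2.const_mul ε) (hY2.div_const ε), integral_const_mul, integral_const_mul,
    integral_div, integral_div, integral_const]
  simp only [probReal_univ, one_smul, ← hv]
  gcongr

end

/-! ### Sums of martingale differences -/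

section

variable {Ω : Type*} {m₀ : MeasurableSpace Ω} {μ : Measure Ω}

/-- Real analogue of `integral_mul_ofReal_eq_zero_of_condExp` for square integrable factors. -/
theorem integral_mul_eq_zero_of_condExp [IsFiniteMeasure μ] {m : MeasurableSpace Ω} (hm : m ≤ m₀)
    {S Y : Ω → ℝ} (hS : StronglyMeasurable[m] S) (hS2 : MemLp S 2 μ) (hY2 : MemLp Y 2 μ)
    (h0 : μ[Y | m] =ᵐ[μ] 0) : ∫ ω, S ω * Y ω ∂μ = 0 := by
  have hSY : Integrable (S * Y) μ := hS2.integrable_mul hY2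
  have h := condExp_mul_of_stronglyMeasurable_left hS hSY (hY2.integrable (by norm_num))
  change ∫ ω, (S * Y) ω ∂μ = 0
  rw [← integral_condExp hm, integral_congr_ae h]
  refine integral_eq_zero_of_ae ?_
  filter_upwards [h0] with ω hω
  simp [hω]

theorem stronglyMeasurable_sum_Ico {ℱ : Filtration ℕ m₀} {X : ℕ → Ω → ℝ}
    (hXm : ∀ k, StronglyMeasurable[ℱ (k + 1)] (X k)) (i j : ℕ) :
    StronglyMeasurable[ℱ j] fun ω => ∑ k ∈ Finset.Ico i j, X k ω :=
  Finset.stronglyMeasurable_fun_sum _ fun k hk =>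
    (hXm k).mono (ℱ.mono (Finset.mem_Ico.1 hk).2)

/-- Orthogonality of martingale differences. -/
theorem integral_sum_Ico_sq [IsFiniteMeasure μ] {ℱ : Filtration ℕ m₀} {X : ℕ → Ω → ℝ} {N : ℕ}
    (hXm : ∀ k, StronglyMeasurable[ℱ (k + 1)] (X k)) (hX2 : ∀ k < N, MemLp (X k) 2 μ)
    (h1 : ∀ k < N, μ[X k | ℱ k] =ᵐ[μ] 0) {i j : ℕ} (hij : i ≤ j) (hjN : j ≤ N) :
    ∫ ω, (∑ k ∈ Finset.Ico i j, X k ω) ^ 2 ∂μ = ∑ k ∈ Finset.Ico i j, ∫ ω, X k ω ^ 2 ∂μ := by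
  induction j, hij using Nat.le_induction with
  | base => simp
  | succ j hij ih =>
    have hS : MemLp (fun ω => ∑ k ∈ Finset.Ico i j, X k ω) 2 μ :=
      memLp_finsetSum _ fun k hk => hX2 k (by have := Finset.mem_Ico.1 hk; omega)
    have hX := hX2 j (by omega)
    have hc := integral_mul_eq_zero_of_condExp (ℱ.le j) (stronglyMeasurable_sum_Ico hXm i j) hS hX
      (h1 j (by omega))
    have hexp (ω : Ω) : (∑ k ∈ Finset.Ico i (j + 1), X k ω) ^ 2 =
        (∑ k ∈ Finset.Ico i j, X k ω) ^ 2 + X j ω ^ 2 +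
          2 * ((∑ k ∈ Finset.Ico i j, X k ω) * X j ω) := by
      rw [Finset.sum_Ico_succ_top hij]
      ring
    have hSX : Integrable (fun ω => (∑ k ∈ Finset.Ico i j, X k ω) * X j ω) μ := hS.integrable_mul hX
    simp only [hexp]
    rw [integral_add (hS.integrable_sq.fun_add hX.integrable_sq) (hSX.const_mul 2),
      integral_add hS.integrable_sq hX.integrable_sq, integral_const_mul, hc, ih (by omega),
      Finset.sum_Ico_succ_top hij]
    ring

/-- Each index `l` lies in at most `M` of the windows `[k - M, k)`. -/
theorem sum_range_sum_Ico_sub_le {g : ℕ → ℝ} (hg : ∀ k, 0 ≤ g k) (M N : ℕ) :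
    ∑ k ∈ Finset.range N, ∑ l ∈ Finset.Ico (k - M) k, g l ≤ M * ∑ l ∈ Finset.range N, g l := by
  rw [Finset.sum_comm' (t' := Finset.range N)
    (s' := fun l => {k ∈ Finset.range N | l ∈ Finset.Ico (k - M) k})
    (by intro k l; simp only [Finset.mem_range, Finset.mem_Ico, Finset.mem_filter]; omega),
    Finset.mul_sum]
  refine Finset.sum_le_sum fun l _ => ?_
  rw [Finset.sum_const, nsmul_eq_mul]
  refine mul_le_mul_of_nonneg_right ?_ (hg l)
  have hsub : {k ∈ Finset.range N | l ∈ Finset.Ico (k - M) k} ⊆ Finset.Ioc l (l + M) := by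
    intro k
    simp only [Finset.mem_range, Finset.mem_Ico, Finset.mem_filter, Finset.mem_Ioc]
    omega
  have := Finset.card_le_card hsub
  rw [Nat.card_Ioc] at this
  exact_mod_cast this.trans (by omega)

/-- Quantitative central limit theorem for martingale differences whose conditional variances,
given the information available `M` steps earlier, are deterministic. -/
theorem norm_integral_cexp_sum_sub_le [IsProbabilityMeasure μ] {ℱ : Filtration ℕ m₀}
    {X : ℕ → Ω → ℝ} {M N : ℕ}
    (hXm : ∀ k, StronglyMeasurable[ℱ (k + 1)] (X k)) (hX4 : ∀ k < N, MemLp (X k) 4 μ)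
    (h1 : ∀ k < N, μ[X k | ℱ k] =ᵐ[μ] 0)
    (h2 : ∀ k < N, μ[fun ω => X k ω ^ 2 | ℱ (k - M)] =ᵐ[μ] fun _ => ∫ ω, X k ω ^ 2 ∂μ)
    (t : ℝ) {ε β : ℝ} (hε : 0 < ε) (hβ : ∀ k < N, ∫ ω, X k ω ^ 4 ∂μ ≤ β) :
    ‖∫ ω, Complex.exp ((t * ∑ k ∈ Finset.range N, X k ω : ℝ) * Complex.I) ∂μ -
        (Real.exp (-(t ^ 2 * (∫ ω, (∑ k ∈ Finset.range N, X k ω) ^ 2 ∂μ) / 2)) : ℂ)‖ ≤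
      2 * |t| ^ 3 * (ε * ∫ ω, (∑ k ∈ Finset.range N, X k ω) ^ 2 ∂μ + N * β / ε) +
        |t| ^ 3 / 4 * (ε * M * ∫ ω, (∑ k ∈ Finset.range N, X k ω) ^ 2 ∂μ + N * β / ε) +
        t ^ 4 / 4 * (N * β) := by
  have hX2 : ∀ k < N, MemLp (X k) 2 μ := fun k hk =>
    (hX4 k hk).mono_exponent (q := 4) (p := 2) (by norm_num)
  have horth : ∀ {i j : ℕ}, i ≤ j → j ≤ N → _ := fun {i j} hij hj =>
    integral_sum_Ico_sq (i := i) (j := j) hXm hX2 h1 hij hj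
  have hs : ∀ {j : ℕ}, j ≤ N → ∫ ω, (∑ k ∈ Finset.range j, X k ω) ^ 2 ∂μ =
      ∑ k ∈ Finset.range j, ∫ ω, X k ω ^ 2 ∂μ := fun {j} hj => by
    simpa only [Finset.range_eq_Ico] using horth (Nat.zero_le j) hj
  have hstep : ∀ j ≤ N,
      ‖∫ ω, Complex.exp ((t * ∑ k ∈ Finset.range j, X k ω : ℝ) * Complex.I) ∂μ -
        (Real.exp (-(t ^ 2 * (∑ k ∈ Finset.range j, ∫ ω, X k ω ^ 2 ∂μ) / 2)) : ℂ)‖ ≤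
      ∑ k ∈ Finset.range j, (2 * |t| ^ 3 * (ε * ∫ ω, X k ω ^ 2 ∂μ + β / ε) +
        |t| ^ 3 / 4 * (ε * ∑ l ∈ Finset.Ico (k - M) k, ∫ ω, X l ω ^ 2 ∂μ + β / ε) +
        t ^ 4 / 4 * β) := by
    intro j
    induction j with
    | zero => simp
    | succ j ih =>
      intro hj
      have hdiff (ω : Ω) : ∑ k ∈ Finset.range j, X k ω - ∑ k ∈ Finset.range (j - M), X k ω =
          ∑ k ∈ Finset.Ico (j - M) j, X k ω := by
        rw [Finset.sum_Ico_eq_sub _ (Nat.sub_le j M)]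
      have hD : MemLp (fun ω => ∑ k ∈ Finset.Ico (j - M) j, X k ω) 2 μ :=
        memLp_finsetSum _ fun k hk => hX2 k (by have := Finset.mem_Ico.1 hk; omega)
      have hmeas (i : ℕ) : StronglyMeasurable[ℱ i] fun ω => ∑ k ∈ Finset.range i, X k ω := by
        simpa only [Finset.range_eq_Ico] using stronglyMeasurable_sum_Ico hXm 0 i
      have h := norm_integral_cexp_add_sub_le (ℱ.mono (Nat.sub_le j M)) (ℱ.le j) (hmeas j)
        (hmeas (j - M)) (hX4 j (by omega)) (by simpa only [hdiff] using hD) (h1 j (by omega))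
        (h2 j (by omega)) t hε (hβ j (by omega))
      simp only [hdiff, ← Finset.sum_range_succ] at h
      rw [horth (Nat.sub_le j M) (by omega)] at h
      rw [Finset.sum_range_succ (fun k => _ + _), add_comm (∑ k ∈ Finset.range j, _)]
      have hexp : (Real.exp (-(t ^ 2 * (∑ k ∈ Finset.range (j + 1), ∫ ω, X k ω ^ 2 ∂μ) / 2)) : ℂ) =
          (Real.exp (-(t ^ 2 * (∫ ω, X j ω ^ 2 ∂μ) / 2)) : ℂ) *
          (Real.exp (-(t ^ 2 * (∑ k ∈ Finset.range j, ∫ ω, X k ω ^ 2 ∂μ) / 2)) : ℂ) := by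
        rw [← Complex.ofReal_mul, ← Real.exp_add, Finset.sum_range_succ]
        congr 2
        ring
      have hle : ‖(Real.exp (-(t ^ 2 * (∫ ω, X j ω ^ 2 ∂μ) / 2)) : ℂ)‖ ≤ 1 := by
        rw [Complex.norm_real, Real.norm_eq_abs, Real.abs_exp, Real.exp_le_one_iff]
        have : 0 ≤ ∫ ω, X j ω ^ 2 ∂μ := integral_nonneg fun ω => sq_nonneg _
        have : 0 ≤ t ^ 2 * (∫ ω, X j ω ^ 2 ∂μ) := by positivity
        linarith
      -- the error made up to step `j` is damped by the factor `exp (-t² σ_j² / 2) ≤ 1`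
      rw [hexp]
      refine (norm_sub_le_norm_sub_add_norm_sub _ _ _).trans (add_le_add h ?_)
      rw [← mul_sub, norm_mul]
      exact (mul_le_of_le_one_left (norm_nonneg _) hle).trans (ih (by omega))
  have hfin := hstep N le_rfl
  rw [hs le_rfl]
  refine hfin.trans ?_
  have hdouble := sum_range_sum_Ico_sub_le (g := fun k => ∫ ω, X k ω ^ 2 ∂μ)
    (fun k => integral_nonneg fun ω => sq_nonneg _) M N
  simp only [Finset.sum_add_distrib, ← Finset.mul_sum, Finset.sum_const, Finset.card_range,
    nsmul_eq_mul]
  rw [mul_assoc ε, mul_div_assoc]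
  gcongr

end

/-! ### Central limit theorem for arrays of martingale differences -/

section

/-- Central limit theorem for arrays of martingale differences whose conditional variances, given
the information available a fixed number `M` of steps earlier, are deterministic, under a uniform
Lyapunov bound on the fourth moments. -/
theorem tendstoInDistribution_of_martingale_differences
    {Ω : ℕ → Type*} {m₀ : ∀ n, MeasurableSpace (Ω n)}
    {μ : (n : ℕ) → Measure (Ω n)} [∀ n, IsProbabilityMeasure (μ n)]
    {ℱ : ∀ n, Filtration ℕ (m₀ n)} {X : ∀ n, ℕ → Ω n → ℝ} {T : ∀ n, Ω n → ℝ} {M : ℕ}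
    (hT : ∀ n, AEMeasurable (T n) (μ n))
    (hTX : ∀ n, T n =ᵐ[μ n] fun ω => ∑ k ∈ Finset.range n, X n k ω)
    (hXm : ∀ n k, StronglyMeasurable[ℱ n (k + 1)] (X n k))
    (hX4 : ∀ n, ∀ k < n, MemLp (X n k) 4 (μ n))
    (h1 : ∀ n, ∀ k < n, (μ n)[X n k | ℱ n k] =ᵐ[μ n] 0)
    (h2 : ∀ n, ∀ k < n, (μ n)[fun ω => X n k ω ^ 2 | ℱ n (k - M)] =ᵐ[μ n]
      fun _ => ∫ ω, X n k ω ^ 2 ∂(μ n))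
    {β : ℕ → ℝ} (hβ : ∀ n, ∀ k < n, ∫ ω, X n k ω ^ 4 ∂(μ n) ≤ β n) (hβ0 : ∀ n, 0 ≤ β n)
    (hβlim : Tendsto (fun n : ℕ => n * β n) atTop (𝓝 0))
    {σsq : ℝ≥0} (hvar : Tendsto (fun n => ∫ ω, T n ω ^ 2 ∂(μ n)) atTop (𝓝 (σsq : ℝ))) :
    TendstoInDistribution T atTop (id : ℝ → ℝ) μ (gaussianReal 0 σsq) := by
  refine ⟨hT, by fun_prop, ProbabilityMeasure.tendsto_iff_tendsto_charFun.2 fun t => ?_⟩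
  simp only [Measure.map_id, ProbabilityMeasure.coe_mk, charFun_gaussianReal]
  have hchar (n : ℕ) : charFun ((μ n).map (T n)) t = ∫ ω, Complex.exp
      ((t * ∑ k ∈ Finset.range n, X n k ω : ℝ) * Complex.I) ∂(μ n) := by
    rw [charFun_apply_real, integral_map (hT n) (by fun_prop)]
    refine integral_congr_ae ?_
    filter_upwards [hTX n] with ω hω
    rw [hω]
    push_cast
    rfl
  have hsq (n : ℕ) : ∫ ω, (∑ k ∈ Finset.range n, X n k ω) ^ 2 ∂(μ n) = ∫ ω, T n ω ^ 2 ∂(μ n) :=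
    integral_congr_ae ((hTX n).mono fun ω hω => by simp only [hω])
  set V : ℕ → ℝ := fun n => ∫ ω, T n ω ^ 2 ∂(μ n) with hV
  set r : ℕ → ℝ := fun n => √(n * β n) with hr
  -- the weight balancing second against fourth moments, shifted to be positive
  set ε : ℕ → ℝ := fun n => r n + 1 / ((n : ℝ) + 1) with hε
  have hr0 : Tendsto r atTop (𝓝 0) := by
    have := hβlim.sqrt
    rwa [Real.sqrt_zero] at this
  have hε0 : Tendsto ε atTop (𝓝 0) := by
    have := hr0.add (tendsto_one_div_add_atTop_nhds_zero_nat (𝕜 := ℝ))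
    rwa [add_zero] at this
  have hεpos (n : ℕ) : 0 < ε n := by
    have : 0 ≤ r n := Real.sqrt_nonneg _
    positivity
  have hratio (n : ℕ) : n * β n / ε n ≤ r n := by
    have h0 : 0 ≤ n * β n := mul_nonneg (Nat.cast_nonneg n) (hβ0 n)
    rw [div_le_iff₀ (hεpos n)]
    calc n * β n = r n * r n := (Real.mul_self_sqrt h0).symm
      _ ≤ r n * ε n := by
        refine mul_le_mul_of_nonneg_left ?_ (Real.sqrt_nonneg _)
        have : 0 ≤ 1 / ((n : ℝ) + 1) := by positivity
        simp only [hε]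
        linarith
  set bd : ℕ → ℝ := fun n => 2 * |t| ^ 3 * (ε n * V n + r n) +
    |t| ^ 3 / 4 * (ε n * M * V n + r n) + t ^ 4 / 4 * (n * β n) with hbd
  have hbd0 : Tendsto bd atTop (𝓝 0) := by
    have := (((hε0.mul hvar).add hr0).const_mul (2 * |t| ^ 3)).add
      ((((hε0.mul_const (M : ℝ)).mul hvar).add hr0).const_mul (|t| ^ 3 / 4)) |>.add
      (hβlim.const_mul (t ^ 4 / 4))
    simpa using this
  have hdiff : Tendsto (fun n => charFun ((μ n).map (T n)) t -
      (Real.exp (-(t ^ 2 * V n / 2)) : ℂ)) atTop (𝓝 0) := by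
    refine squeeze_zero_norm (fun n => ?_) hbd0
    have h := norm_integral_cexp_sum_sub_le (hXm n) (hX4 n) (h1 n) (h2 n) t (hεpos n) (hβ n)
    rw [hsq n, ← hchar n] at h
    refine h.trans ?_
    simp only [hbd]
    gcongr 2 * |t| ^ 3 * (_ + ?_) + |t| ^ 3 / 4 * (_ + ?_) + _
    · exact hratio n
    · exact hratio n
  have hgauss : Tendsto (fun n => (Real.exp (-(t ^ 2 * V n / 2)) : ℂ)) atTop
      (𝓝 (Real.exp (-(t ^ 2 * σsq / 2)) : ℂ)) := by
    refine (Complex.continuous_ofReal.tendsto _).comp ((Real.continuous_exp.tendsto _).comp ?_)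
    exact ((hvar.const_mul (t ^ 2)).div_const 2).neg
  have := hdiff.add hgauss
  simp only [sub_add_cancel, zero_add] at this
  convert this using 2
  push_cast
  congr 1
  simp
  ring

end

/-! ### Expansion of the trace over closed paths -/

section

/-- Entries of a matrix power as sums over walks with prescribed endpoints. -/
theorem matrix_pow_apply_eq_sum {α R : Type*} [Fintype α] [DecidableEq α] [CommSemiring R]
    (A : Matrix α α R) (r : ℕ) (i j : α) :
    (A ^ r) i j = ∑ w : Fin (r + 1) → α, if w 0 = i ∧ w (Fin.last r) = j then
      ∏ l : Fin r, A (w l.castSucc) (w l.succ) else 0 := by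
  induction r generalizing i with
  | zero =>
    rw [← (Equiv.funUnique (Fin 1) α).symm.sum_comp]
    simp only [Equiv.funUnique_symm_apply, pow_zero, Matrix.one_apply, uniqueElim_const,
      Fin.prod_univ_zero, ite_and, Finset.sum_ite_eq', Finset.mem_univ, if_true]
  | succ r ih =>
    rw [pow_succ', Matrix.mul_apply, ← (Fin.consEquiv fun _ => α).sum_comp, Fintype.sum_prod_type]
    simp only [ih, Finset.mul_sum]
    rw [Finset.sum_comm, Finset.sum_comm (s := Finset.univ (α := α))]
    refine Finset.sum_congr rfl fun w _ => ?_
    simp only [Fin.consEquiv, Equiv.coe_fn_mk, Fin.cons_zero, ← Fin.succ_last, Fin.cons_succ,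
      Fin.prod_univ_succ, Fin.castSucc_zero, ← Fin.succ_castSucc, mul_ite, mul_zero, ite_and,
      Finset.sum_ite_eq, Finset.sum_ite_eq', Finset.mem_univ, if_true]

theorem trace_pow_eq_sum {α R : Type*} [Fintype α] [DecidableEq α] [CommSemiring R]
    (A : Matrix α α R) (r : ℕ) :
    (A ^ r).trace = ∑ w : Fin (r + 1) → α, if w (Fin.last r) = w 0 then
      ∏ l : Fin r, A (w l.castSucc) (w l.succ) else 0 := by
  simp only [Matrix.trace, Matrix.diag, matrix_pow_apply_eq_sum]
  rw [Finset.sum_comm]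
  refine Finset.sum_congr rfl fun w _ => ?_
  simp only [ite_and, Finset.sum_ite_eq, Finset.mem_univ, if_true]

theorem jacobi_eq_zero {n : ℕ} (a : Fin n → ℝ) (b : Fin (n - 1) → ℝ) {i j : Fin n}
    (h : ¬ |((j : ℕ) : ℤ) - ((i : ℕ) : ℤ)| ≤ 1) : jacobi a b i j = 0 := by
  have h1 : i ≠ j := by rintro rfl; simp at h
  have h2 : ¬ (i : ℕ) + 1 = j := by intro h'; apply h; rw [← h']; simp
  have h3 : ¬ (j : ℕ) + 1 = i := by intro h'; apply h; rw [← h']; simp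
  simp [jacobi, h1, h2, h3]

/-- A sequence of at least one and at most `m + 1` indices in `Fin n`, i.e. the vertices of a path
of length at most `m`. -/
abbrev PathIndex (m n : ℕ) : Type := Σ r : Fin (m + 1), Fin ((r : ℕ) + 1) → Fin n

variable {Ω : Type*} {n : ℕ}

theorem pathVar_eq_zero (a : Fin n → Ω → ℝ) (b : Fin (n - 1) → Ω → ℝ) {r : ℕ}
    {w : Fin (r + 1) → Fin n} (hclosed : w (Fin.last r) = w 0) (h : ¬ IsAdmissible w) (ω : Ω) :
    pathVar a b w ω = 0 := by
  simp only [IsAdmissible, hclosed, true_and, not_forall] at h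
  obtain ⟨l, hl⟩ := h
  exact Finset.prod_eq_zero (Finset.mem_univ l) (jacobi_eq_zero _ _ hl)

open Classical in
/-- The trace of `p(J)` as a linear combination of the path variables of admissible paths. -/
theorem linStat_eq_sum (a : Fin n → Ω → ℝ) (b : Fin (n - 1) → Ω → ℝ) (p : Polynomial ℝ) (ω : Ω) :
    linStat a b p ω = ∑ q : PathIndex p.natDegree n with IsAdmissible q.2,
      p.coeff q.1 * pathVar a b q.2 ω := by
  rw [linStat, Polynomial.aeval_eq_sum_range, Matrix.trace_sum, Finset.sum_filter,
    Fintype.sum_sigma, Finset.sum_range]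
  refine Finset.sum_congr rfl fun r _ => ?_
  rw [Matrix.trace_smul, trace_pow_eq_sum, smul_eq_mul, Finset.mul_sum]
  refine Finset.sum_congr rfl fun w _ => ?_
  by_cases hc : w (Fin.last r) = w 0
  · by_cases hw : IsAdmissible w
    · simp [hc, hw, pathVar]
    · rw [if_pos hc, if_neg hw]
      have := pathVar_eq_zero a b hc hw ω
      rw [pathVar] at this
      rw [this, mul_zero]
  · rw [if_neg hc, if_neg (fun h : IsAdmissible w => hc h.1), mul_zero]

/-- An admissible path of length `r` has diameter at most `r`. -/
theorem IsAdmissible.abs_sub_le {r : ℕ} {w : Fin (r + 1) → Fin n} (hw : IsAdmissible w)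
    (i j : Fin (r + 1)) : |((w i : ℕ) : ℤ) - ((w j : ℕ) : ℤ)| ≤ r := by
  have hmono : ∀ d : ℕ, ∀ i j : Fin (r + 1), (i : ℕ) + d = j →
      |((w j : ℕ) : ℤ) - ((w i : ℕ) : ℤ)| ≤ d := by
    intro d
    induction d with
    | zero =>
      intro i j hij
      have : i = j := Fin.ext (by simpa using hij)
      simp [this]
    | succ d ih =>
      intro i j hij
      have hj := j.isLt
      have h1 := ih i ⟨i + d, by omega⟩ rfl
      have h2 := hw.2 ⟨i + d, by omega⟩
      have h3 : (⟨i + d, by omega⟩ : Fin r).succ = j := Fin.ext (by simp; omega)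
      have h4 : (⟨i + d, by omega⟩ : Fin r).castSucc = ⟨i + d, by omega⟩ := rfl
      rw [h3, h4] at h2
      rw [abs_le] at h1 h2 ⊢
      push_cast
      omega
  have hi := i.isLt
  have hj := j.isLt
  rcases le_total (i : ℕ) j with h | h
  · have := hmono (j - i) i j (by omega)
    rw [abs_le] at this ⊢
    omega
  · have := hmono (i - j) j i (by omega)
    rw [abs_le] at this ⊢
    omega

open Classical in
/-- The admissible paths of length at most `m` that stay within distance `m` of the index `j`. -/
noncomputable def pathsNear (m n j : ℕ) : Finset (PathIndex m n) :=
  {q | IsAdmissible q.2 ∧ ∀ l, j ≤ q.2 l + m ∧ q.2 l ≤ j + m}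

/-- The number of paths near a given index is bounded independently of the size of the matrix. -/
theorem card_pathsNear_le (m n j : ℕ) :
    (pathsNear m n j).card ≤ ∑ r : Fin (m + 1), (2 * m + 1) ^ ((r : ℕ) + 1) := by
  classical
  have hcard : ({i : Fin n | j ≤ i + m ∧ i ≤ j + m} : Finset (Fin n)).card ≤ 2 * m + 1 := by
    calc _ ≤ (Finset.Icc (j - m) (j + m)).card :=
          Finset.card_le_card_of_injOn (fun i : Fin n => (i : ℕ))
            (fun i hi => by
              simp only [Finset.coe_filter, Set.mem_ofPred_eq, Finset.mem_univ, true_and] at hi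
              simp only [Finset.coe_Icc, Set.mem_Icc]
              omega) Fin.val_injective.injOn
      _ ≤ 2 * m + 1 := by rw [Nat.card_Icc]; omega
  have hsub : pathsNear m n j ⊆ Finset.univ.sigma fun r : Fin (m + 1) =>
      Fintype.piFinset fun _ : Fin ((r : ℕ) + 1) =>
        ({i : Fin n | j ≤ i + m ∧ i ≤ j + m} : Finset (Fin n)) := by
    intro q hq
    simp only [pathsNear, Finset.mem_filter, Finset.mem_univ, true_and] at hq
    simpa using hq.2
  refine (Finset.card_le_card hsub).trans ?_
  rw [Finset.card_sigma]
  refine Finset.sum_le_sum fun r _ => ?_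
  rw [Fintype.card_piFinset_const]
  exact Nat.pow_le_pow_left hcard _

end

/-! ### σ-algebras generated by blocks of entries -/

section

variable {Ω : Type*} {n : ℕ}

/-- The position of an entry of the Jacobi matrix: the index of the first row it appears in. -/
def entryPos : Fin n ⊕ Fin (n - 1) → ℕ :=
  Sum.elim (fun i => (i : ℕ)) fun i => (i : ℕ)

/-- The σ-algebra generated by the entries of the Jacobi matrix with position in `S`. -/
@[reducible] def entrySigma (a : Fin n → Ω → ℝ) (b : Fin (n - 1) → Ω → ℝ) (S : Set ℕ) :
    MeasurableSpace Ω :=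
  ⨆ i ∈ entryPos ⁻¹' S, MeasurableSpace.comap (Sum.elim a b i) inferInstance

theorem entryFiltration_eq (a : Fin n → Ω → ℝ) (b : Fin (n - 1) → Ω → ℝ) (k : ℕ) :
    entryFiltration a b k = entrySigma a b (Set.Iio k) := by
  simp only [entryFiltration, entrySigma, iSup_sum]
  rfl

theorem entrySigma_mono (a : Fin n → Ω → ℝ) (b : Fin (n - 1) → Ω → ℝ) {S T : Set ℕ} (h : S ⊆ T) :
    entrySigma a b S ≤ entrySigma a b T :=
  biSup_mono fun _ hi => h hi

theorem entrySigma_union (a : Fin n → Ω → ℝ) (b : Fin (n - 1) → Ω → ℝ) (S T : Set ℕ) :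
    entrySigma a b (S ∪ T) = entrySigma a b S ⊔ entrySigma a b T := by
  rw [entrySigma, Set.preimage_union, iSup_union]

theorem comap_le_entrySigma (a : Fin n → Ω → ℝ) (b : Fin (n - 1) → Ω → ℝ) {S : Set ℕ}
    {i : Fin n ⊕ Fin (n - 1)} (hi : entryPos i ∈ S) :
    MeasurableSpace.comap (Sum.elim a b i) inferInstance ≤ entrySigma a b S :=
  le_iSup₂_of_le i hi le_rfl

/-- The path variable depends only on the entries at positions visited by the path. -/
theorem measurable_pathVar (a : Fin n → Ω → ℝ) (b : Fin (n - 1) → Ω → ℝ) {S : Set ℕ} {r : ℕ}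
    {w : Fin (r + 1) → Fin n} (hw : ∀ l, (w l : ℕ) ∈ S) :
    Measurable[entrySigma a b S] (pathVar a b w) := by
  have hentry : ∀ i j : Fin n, (i : ℕ) ∈ S → (j : ℕ) ∈ S →
      Measurable[entrySigma a b S] fun ω => randomJacobi a b ω i j := by
    intro i j hi hj
    have hmeas : ∀ e : Fin n ⊕ Fin (n - 1), entryPos e ∈ S →
        Measurable[entrySigma a b S] (Sum.elim a b e) := fun e he =>
      (comap_measurable _).mono (comap_le_entrySigma a b he) le_rfl
    simp only [randomJacobi, jacobi, Matrix.of_apply]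
    split_ifs with h1 h2 h3
    · exact hmeas (.inl i) hi
    · exact hmeas (.inr ⟨i, by omega⟩) hi
    · exact hmeas (.inr ⟨j, by omega⟩) hj
    · exact measurable_const
  exact Finset.measurable_fun_prod _ fun l _ => hentry _ _ (hw _) (hw _)

section Measure

variable {m₀ : MeasurableSpace Ω} {μ : Measure Ω} {a : Fin n → Ω → ℝ} {b : Fin (n - 1) → Ω → ℝ}

theorem entrySigma_le (ha : ∀ i, Measurable (a i)) (hb : ∀ i, Measurable (b i)) (S : Set ℕ) :
    entrySigma a b S ≤ m₀ :=
  iSup₂_le fun i _ => by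
    cases i with
    | inl i => exact (ha i).comap_le
    | inr i => exact (hb i).comap_le

theorem indep_entrySigma (ha : ∀ i, Measurable (a i)) (hb : ∀ i, Measurable (b i))
    (h_indep : iIndepFun (Sum.elim a b) μ) {S T : Set ℕ} (hST : Disjoint S T) :
    Indep (entrySigma a b S) (entrySigma a b T) μ := by
  refine indep_iSup_of_disjoint (fun i => ?_) h_indep.iIndep (hST.preimage entryPos)
  cases i with
  | inl i => exact (ha i).comap_le
  | inr i => exact (hb i).comap_le

/-- `entryFiltration` as a filtration in the sense of Mathlib. -/
def entryFilt (ha : ∀ i, Measurable (a i)) (hb : ∀ i, Measurable (b i)) : Filtration ℕ m₀ where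
  seq := entryFiltration a b
  mono' i j hij := by
    simp only [entryFiltration_eq]
    exact entrySigma_mono a b (Set.Iio_subset_Iio hij)
  le' i := by
    rw [entryFiltration_eq]
    exact entrySigma_le ha hb _

/-- A path lying strictly before or strictly after `j` does not contribute to the martingale
increment of index `j`: its variable is known before the entries at `j` are revealed in the first
case, and independent of all entries up to `j` in the second. -/
theorem increment_pathVar_ae_eq_zero [IsProbabilityMeasure μ]
    (ha : ∀ i, Measurable (a i)) (hb : ∀ i, Measurable (b i))
    (h_indep : iIndepFun (Sum.elim a b) μ) {r : ℕ} {w : Fin (r + 1) → Fin n}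
    (hint : Integrable (pathVar a b w) μ) {j : ℕ}
    (h : (∀ l, (w l : ℕ) < j) ∨ ∀ l, j < (w l : ℕ)) :
    increment μ a b (j + 1) (pathVar a b w) =ᵐ[μ] 0 := by
  have hle := entrySigma_le (m₀ := m₀) ha hb
  rcases h with h | h
  · have h1 : ∀ k, j ≤ k → μ[pathVar a b w | entryFiltration a b k] = pathVar a b w := by
      intro k hk
      rw [entryFiltration_eq]
      have hw : ∀ l, (w l : ℕ) ∈ Set.Iio k := fun l => lt_of_lt_of_le (h l) hk
      exact condExp_of_stronglyMeasurable (hle _) (measurable_pathVar a b hw).stronglyMeasurable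
        hint
    refine ae_of_all _ fun ω => ?_
    simp [increment, h1 (j + 1) (Nat.le_succ j), h1 j le_rfl]
  · have h1 : ∀ k, k ≤ j + 1 → μ[pathVar a b w | entryFiltration a b k] =ᵐ[μ]
        fun _ => ∫ ω, pathVar a b w ω ∂μ := by
      intro k hk
      have hw : ∀ l, (w l : ℕ) ∈ Set.Ioi j := h
      rw [entryFiltration_eq]
      refine condExp_indep_eq (hle (Set.Ioi j)) (hle _)
        (measurable_pathVar a b hw).stronglyMeasurable (indep_entrySigma ha hb h_indep ?_)
      rw [Set.disjoint_left]
      intro x hx hx'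
      simp only [Set.mem_Ioi, Set.mem_Iio] at hx hx'
      omega
    filter_upwards [h1 (j + 1) le_rfl, h1 j (Nat.le_succ j)] with ω e1 e2
    simp [increment, e1, e2]

/-- The conditional expectation of a variable depending on the entries from position `i` on,
given the entries before position `k`, depends only on the entries from position `i` on. -/
theorem condExp_entryFiltration_eq [IsProbabilityMeasure μ]
    (ha : ∀ i, Measurable (a i)) (hb : ∀ i, Measurable (b i))
    (h_indep : iIndepFun (Sum.elim a b) μ) {f : Ω → ℝ} (hf : Integrable f μ) {i k : ℕ}
    (hik : i ≤ k) (hfm : StronglyMeasurable[entrySigma a b (Set.Ici i)] f) :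
    μ[f | entryFiltration a b k] =ᵐ[μ] μ[f | entrySigma a b (Set.Ico i k)] := by
  have hle := entrySigma_le (m₀ := m₀) ha hb
  have hunion : entryFiltration a b k =
      entrySigma a b (Set.Ico i k) ⊔ entrySigma a b (Set.Iio i) := by
    rw [entryFiltration_eq, ← entrySigma_union]
    congr 1
    ext x
    simp only [Set.mem_Iio, Set.mem_union, Set.mem_Ico]
    omega
  rw [hunion]
  refine condExp_sup_of_indep (entrySigma_mono a b fun x hx => hx.1) (hle _) (hle _) hf hfm
    (indep_entrySigma ha hb h_indep ?_)
  rw [Set.disjoint_left]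
  intro x hx hx'
  simp only [Set.mem_Ici, Set.mem_Iio] at hx hx'
  omega

end Measure

end

/-! ### Martingale increments of path variables and of the linear statistic -/

section

theorem sum_pow_four_le {ι : Type*} (s : Finset ι) (f : ι → ℝ) :
    (∑ i ∈ s, f i) ^ 4 ≤ (s.card : ℝ) ^ 3 * ∑ i ∈ s, f i ^ 4 := by
  have h1 : (∑ i ∈ s, f i) ^ 2 ≤ s.card * ∑ i ∈ s, f i ^ 2 := sq_sum_le_card_mul_sum_sq
  have h2 : (∑ i ∈ s, f i ^ 2) ^ 2 ≤ s.card * ∑ i ∈ s, (f i ^ 2) ^ 2 := sq_sum_le_card_mul_sum_sq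
  calc (∑ i ∈ s, f i) ^ 4 = ((∑ i ∈ s, f i) ^ 2) ^ 2 := by ring
    _ ≤ (s.card * ∑ i ∈ s, f i ^ 2) ^ 2 := pow_le_pow_left₀ (sq_nonneg _) h1 2
    _ = (s.card : ℝ) ^ 2 * (∑ i ∈ s, f i ^ 2) ^ 2 := by ring
    _ ≤ (s.card : ℝ) ^ 2 * (s.card * ∑ i ∈ s, (f i ^ 2) ^ 2) := by gcongr
    _ = _ := by simp only [← pow_mul]; ring

variable {Ω : Type*} {m₀ : MeasurableSpace Ω} {μ : Measure Ω}

theorem memLp_four_of_integrable {f : Ω → ℝ} (hf : AEStronglyMeasurable f μ)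
    (h : Integrable (fun ω => f ω ^ 4) μ) : MemLp f 4 μ := by
  refine (integrable_norm_rpow_iff hf (by norm_num) (by norm_num)).1
    (h.congr (ae_of_all _ fun ω => ?_))
  have h4 : (4 : ENNReal).toReal = ((4 : ℕ) : ℝ) := by norm_num
  simp only [h4, Real.rpow_natCast, Real.norm_eq_abs]
  exact (Even.pow_abs (by decide) _).symm

/-- A uniform bound on the fourth moments of the rescaled terms of a linear combination bounds that
of the combination. -/
theorem integral_sum_pow_four_le {ι : Type*} (s : Finset ι) (c : ι → ℝ) (D : ι → Ω → ℝ)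
    (hD : ∀ i ∈ s, Integrable (fun ω => D i ω ^ 4) μ) (v : ℝ) {B K : ℝ}
    (hB : ∀ i ∈ s, v ^ 4 * ∫ ω, D i ω ^ 4 ∂μ ≤ B) (hK : ∀ i ∈ s, |c i| ≤ K) :
    ∫ ω, (v * ∑ i ∈ s, c i * D i ω) ^ 4 ∂μ ≤ (s.card : ℝ) ^ 4 * K ^ 4 * B := by
  have hint : ∀ i ∈ s, Integrable (fun ω => v ^ 4 * c i ^ 4 * D i ω ^ 4) μ := fun i hi =>
    (hD i hi).const_mul _
  calc ∫ ω, (v * ∑ i ∈ s, c i * D i ω) ^ 4 ∂μ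
      ≤ ∫ ω, (s.card : ℝ) ^ 3 * ∑ i ∈ s, v ^ 4 * c i ^ 4 * D i ω ^ 4 ∂μ := by
        refine integral_mono_of_nonneg (ae_of_all _ fun ω => ?_)
          ((integrable_finsetSum s hint).const_mul _) (ae_of_all _ fun ω => ?_)
        · exact Even.pow_nonneg (by decide) _
        · simp only [Finset.mul_sum s _ v]
          refine (sum_pow_four_le s _).trans_eq ?_
          congr 1
          exact Finset.sum_congr rfl fun i _ => by ring
    _ = (s.card : ℝ) ^ 3 * ∑ i ∈ s, c i ^ 4 * (v ^ 4 * ∫ ω, D i ω ^ 4 ∂μ) := by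
        rw [integral_const_mul, integral_finsetSum s hint]
        congr 1
        refine Finset.sum_congr rfl fun i _ => ?_
        rw [integral_const_mul]
        ring
    _ ≤ (s.card : ℝ) ^ 3 * ∑ i ∈ s, K ^ 4 * B := by
        refine mul_le_mul_of_nonneg_left (Finset.sum_le_sum fun i hi => ?_) (by positivity)
        have hc : c i ^ 4 ≤ K ^ 4 := by
          rw [← Even.pow_abs (by decide : Even 4) (c i)]
          exact pow_le_pow_left₀ (abs_nonneg _) (hK i hi) 4
        exact mul_le_mul hc (hB i hi)
          (mul_nonneg (Even.pow_nonneg (by decide) _)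
            (integral_nonneg fun ω => Even.pow_nonneg (by decide) _))
          (Even.pow_nonneg (by decide) _)
    _ = _ := by rw [Finset.sum_const, nsmul_eq_mul]; ring

variable {n : ℕ} {a : Fin n → Ω → ℝ} {b : Fin (n - 1) → Ω → ℝ}

theorem increment_sum_ae_eq {ι : Type*} (s : Finset ι) (c : ι → ℝ) (ξ : ι → Ω → ℝ)
    (hξ : ∀ i ∈ s, Integrable (ξ i) μ) (k : ℕ) :
    increment μ a b k (fun ω => ∑ i ∈ s, c i * ξ i ω) =ᵐ[μ]
      fun ω => ∑ i ∈ s, c i * increment μ a b k (ξ i) ω := by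
  have h : ∀ l : ℕ, μ[fun ω => ∑ i ∈ s, c i * ξ i ω | entryFiltration a b l] =ᵐ[μ]
      fun ω => ∑ i ∈ s, c i * (μ[ξ i | entryFiltration a b l]) ω := by
    intro l
    have hfun : (fun ω => ∑ i ∈ s, c i * ξ i ω) = ∑ i ∈ s, c i • ξ i := by
      ext ω
      simp
    have h1 : ∀ᵐ ω ∂μ, ∀ i ∈ s, (μ[c i • ξ i | entryFiltration a b l]) ω =
        c i * (μ[ξ i | entryFiltration a b l]) ω :=
      (Finset.eventually_all s).2 fun i _ => condExp_smul (c i) (ξ i) _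
    rw [hfun]
    filter_upwards [condExp_finsetSum (fun i hi => (hξ i hi).smul (c i)) (entryFiltration a b l),
      h1] with ω e1 e2
    rw [e1, Finset.sum_apply]
    exact Finset.sum_congr rfl e2
  filter_upwards [h k, h (k - 1)] with ω e1 e2
  simp only [increment, e1, e2, ← Finset.sum_sub_distrib, mul_sub]

/-- Only the paths near `j` contribute to the increment of the linear statistic at `j`: an admissible
path of length at most `m` that meets both sides of `j` stays within distance `m` of `j`. -/
theorem increment_linStat_ae_eq [IsProbabilityMeasure μ]
    (ha : ∀ i, Measurable (a i)) (hb : ∀ i, Measurable (b i))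
    (h_indep : iIndepFun (Sum.elim a b) μ) (p : Polynomial ℝ)
    (h_int : ∀ q : PathIndex p.natDegree n, IsAdmissible q.2 → Integrable (pathVar a b q.2) μ) (j : ℕ) :
    increment μ a b (j + 1) (linStat a b p) =ᵐ[μ] fun ω => ∑ q ∈ pathsNear p.natDegree n j,
      p.coeff q.1 * increment μ a b (j + 1) (pathVar a b q.2) ω := by
  classical
  have hzero : ∀ᵐ ω ∂μ, ∀ q : PathIndex p.natDegree n, IsAdmissible q.2 →
      q ∉ pathsNear p.natDegree n j → increment μ a b (j + 1) (pathVar a b q.2) ω = 0 := by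
    refine ae_all_iff.2 fun q => ?_
    by_cases hq : IsAdmissible q.2 ∧ q ∉ pathsNear p.natDegree n j
    · refine (increment_pathVar_ae_eq_zero ha hb h_indep (h_int q hq.1) ?_).mono
        fun ω h _ _ => h
      by_contra! hcon
      obtain ⟨⟨l₁, h₁⟩, l₂, h₂⟩ := hcon
      refine hq.2 ?_
      simp only [pathsNear, Finset.mem_filter, Finset.mem_univ, true_and]
      refine ⟨hq.1, fun l => ?_⟩
      have e₁ := hq.1.abs_sub_le l₁ l
      have e₂ := hq.1.abs_sub_le l₂ l
      have hr := q.1.isLt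
      rw [abs_le] at e₁ e₂
      omega
    · exact ae_of_all _ fun ω h1 h2 => absurd ⟨h1, h2⟩ hq
  have hlin : linStat a b p = fun ω => ∑ q : PathIndex p.natDegree n with IsAdmissible q.2,
      p.coeff q.1 * pathVar a b q.2 ω := funext (linStat_eq_sum a b p)
  rw [hlin]
  filter_upwards [increment_sum_ae_eq (a := a) (b := b)
    ({q : PathIndex p.natDegree n | IsAdmissible q.2} : Finset _) (fun q => p.coeff q.1)
    (fun q => pathVar a b q.2) (fun q hq => h_int q (by simpa using hq)) (j + 1), hzero]
    with ω e1 e2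
  rw [e1]
  refine (Finset.sum_subset (fun q hq => ?_) fun q hq hq' => ?_).symm
  · simp only [pathsNear, Finset.mem_filter, Finset.mem_univ, true_and] at hq ⊢
    exact hq.1
  · rw [e2 q (by simpa using hq) hq', mul_zero]

/-- The square of an increment of the linear statistic at `j` is independent of the entries at
positions before `j - deg p`. -/
theorem condExp_increment_linStat_sq [IsProbabilityMeasure μ]
    (ha : ∀ i, Measurable (a i)) (hb : ∀ i, Measurable (b i))
    (h_indep : iIndepFun (Sum.elim a b) μ) (p : Polynomial ℝ)
    (h_int : ∀ q : PathIndex p.natDegree n, IsAdmissible q.2 → Integrable (pathVar a b q.2) μ) (j : ℕ)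
    (v : ℝ) :
    μ[fun ω => (v * increment μ a b (j + 1) (linStat a b p) ω) ^ 2 |
        entryFiltration a b (j - p.natDegree)] =ᵐ[μ]
      fun _ => ∫ ω, (v * increment μ a b (j + 1) (linStat a b p) ω) ^ 2 ∂μ := by
  have hle := entrySigma_le (m₀ := m₀) ha hb
  set i := j - p.natDegree with hi
  have hnear : ∀ q ∈ pathsNear p.natDegree n j, IsAdmissible q.2 ∧ ∀ l, (q.2 l : ℕ) ∈ Set.Ici i := by
    intro q hq
    simp only [pathsNear, Finset.mem_filter, Finset.mem_univ, true_and] at hq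
    refine ⟨hq.1, fun l => ?_⟩
    have := (hq.2 l).1
    simp only [Set.mem_Ici]
    omega
  -- the part of the statistic that contributes to the increment
  set f : Ω → ℝ := fun ω => ∑ q ∈ pathsNear p.natDegree n j, p.coeff q.1 * pathVar a b q.2 ω with hf
  have hfint : Integrable f μ :=
    integrable_finsetSum _ fun q hq => (h_int q (hnear q hq).1).const_mul _
  have hfm : StronglyMeasurable[entrySigma a b (Set.Ici i)] f :=
    Finset.stronglyMeasurable_fun_sum _ fun q hq =>
      ((measurable_pathVar a b (hnear q hq).2).const_mul _).stronglyMeasurable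
  -- a version of the squared increment that is measurable with respect to the entries from `i` on
  set g : Ω → ℝ := fun ω => (v * ((μ[f | entrySigma a b (Set.Ico i (j + 1))]) ω -
    (μ[f | entrySigma a b (Set.Ico i j)]) ω)) ^ 2 with hg
  have hgm : StronglyMeasurable[entrySigma a b (Set.Ici i)] g := by
    have h1 : ∀ k, StronglyMeasurable[entrySigma a b (Set.Ici i)]
        (μ[f | entrySigma a b (Set.Ico i k)]) := fun k =>
      stronglyMeasurable_condExp.mono (entrySigma_mono a b fun x hx => hx.1)
    exact (((h1 (j + 1)).sub (h1 j)).const_mul v).pow 2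
  have hae : (fun ω => (v * increment μ a b (j + 1) (linStat a b p) ω) ^ 2) =ᵐ[μ] g := by
    filter_upwards [increment_linStat_ae_eq ha hb h_indep p h_int j,
      increment_sum_ae_eq (a := a) (b := b) (pathsNear p.natDegree n j) (fun q => p.coeff q.1)
        (fun q => pathVar a b q.2) (fun q hq => h_int q (hnear q hq).1) (j + 1),
      condExp_entryFiltration_eq ha hb h_indep hfint (k := j + 1) (by omega) hfm,
      condExp_entryFiltration_eq ha hb h_indep hfint (k := j) (by omega) hfm] with ω e1 e2 e3 e4
    rw [e1, ← e2]
    simp only [hg, increment, Nat.add_sub_cancel, ← hf, e3, e4]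
  have hind : Indep (entrySigma a b (Set.Ici i)) (entrySigma a b (Set.Iio i)) μ :=
    indep_entrySigma ha hb h_indep (Set.disjoint_left.2 fun x hx hx' => by
      simp only [Set.mem_Ici, Set.mem_Iio] at hx hx'
      omega)
  rw [entryFiltration_eq]
  refine (condExp_congr_ae hae).trans ?_
  rw [integral_congr_ae hae]
  exact condExp_indep_eq (hle _) (hle _) hgm hind

end

/-! ### Convergence of the linear statistic -/

section Increments

variable {Ω : Type*} {m₀ : MeasurableSpace Ω} {μ : Measure Ω} {n : ℕ} {a : Fin n → Ω → ℝ}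
  {b : Fin (n - 1) → Ω → ℝ}

theorem measurable_linStat (a : Fin n → Ω → ℝ) (b : Fin (n - 1) → Ω → ℝ) (p : Polynomial ℝ) :
    Measurable[entryFiltration a b n] (linStat a b p) := by
  classical
  rw [entryFiltration_eq, funext (linStat_eq_sum a b p)]
  have hw : ∀ q : PathIndex p.natDegree n, ∀ l, (q.2 l : ℕ) ∈ Set.Iio n := fun q l => (q.2 l).isLt
  exact Finset.measurable_fun_sum _ fun q _ => (measurable_pathVar a b (hw q)).const_mul _

theorem integrable_linStat (p : Polynomial ℝ)
    (h_int : ∀ q : PathIndex p.natDegree n, IsAdmissible q.2 → Integrable (pathVar a b q.2) μ) :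
    Integrable (linStat a b p) μ := by
  classical
  rw [funext (linStat_eq_sum a b p)]
  exact integrable_finsetSum _ fun q hq => (h_int q (by simpa using hq)).const_mul _

/-- The centred linear statistic is the sum of its martingale increments. -/
theorem sum_increment_linStat [IsProbabilityMeasure μ]
    (ha : ∀ i, Measurable (a i)) (hb : ∀ i, Measurable (b i)) (p : Polynomial ℝ)
    (h_int : ∀ q : PathIndex p.natDegree n, IsAdmissible q.2 → Integrable (pathVar a b q.2) μ) (ω : Ω) :
    ∑ j ∈ Finset.range n, increment μ a b (j + 1) (linStat a b p) ω =
      linStat a b p ω - ∫ ω', linStat a b p ω' ∂μ := by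
  have hbot : entryFiltration a b 0 = ⊥ := by simp [entryFiltration]
  have htel := Finset.sum_range_sub (fun k => (μ[linStat a b p | entryFiltration a b k]) ω) n
  have hle : entryFiltration a b n ≤ m₀ := (entryFilt ha hb).le n
  simp only [increment, Nat.add_sub_cancel]
  rw [htel, hbot, condExp_bot, condExp_of_stronglyMeasurable hle
    (measurable_linStat a b p).stronglyMeasurable (integrable_linStat p h_int)]

theorem condExp_increment_ae_eq_zero [IsFiniteMeasure μ] (ha : ∀ i, Measurable (a i))
    (hb : ∀ i, Measurable (b i)) (ξ : Ω → ℝ) (v : ℝ) (j : ℕ) :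
    μ[fun ω => v * increment μ a b (j + 1) ξ ω | entryFiltration a b j] =ᵐ[μ] 0 := by
  have hle : ∀ k, entryFiltration a b k ≤ m₀ := (entryFilt ha hb).le
  have hmono : entryFiltration a b j ≤ entryFiltration a b (j + 1) :=
    (entryFilt ha hb).mono (Nat.le_succ j)
  have hfun : (fun ω => v * increment μ a b (j + 1) ξ ω) =
      v • (μ[ξ | entryFiltration a b (j + 1)] - μ[ξ | entryFiltration a b j]) := by
    ext ω
    simp [increment]
  rw [hfun]
  filter_upwards [condExp_smul v
    (μ[ξ | entryFiltration a b (j + 1)] - μ[ξ | entryFiltration a b j]) (entryFiltration a b j),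
    condExp_sub (μ := μ) (f := μ[ξ | entryFiltration a b (j + 1)])
      (g := μ[ξ | entryFiltration a b j]) integrable_condExp integrable_condExp
      (entryFiltration a b j),
    condExp_condExp_of_le (f := ξ) (μ := μ) hmono (hle (j + 1)),
    condExp_condExp_of_le (f := ξ) (μ := μ) (le_refl (entryFiltration a b j)) (hle j)]
    with ω e1 e2 e3 e4
  simp [e1, e2, e3, e4]

end Increments

end RandomJacobi

open RandomJacobi in
theorem theorem3p4
    {Ω : ℕ → Type*} [∀ n, MeasurableSpace (Ω n)]
    (μ : (n : ℕ) → Measure (Ω n)) [∀ n, IsProbabilityMeasure (μ n)]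
    (a : (n : ℕ) → Fin n → Ω n → ℝ) (b : (n : ℕ) → Fin (n - 1) → Ω n → ℝ)
    (ha : ∀ n i, Measurable (a n i)) (hb : ∀ n i, Measurable (b n i))
    (hb_pos : ∀ n i, ∀ᵐ ω ∂(μ n), 0 < b n i ω)
    (h_indep : ∀ n, iIndepFun (Sum.elim (a n) (b n)) (μ n))
    (p : Polynomial ℝ)
    (h_int : ∀ n, ∀ r ≤ p.natDegree, ∀ w : Fin (r + 1) → Fin n, RandomJacobi.IsAdmissible w →
      Integrable (RandomJacobi.pathVar (a n) (b n) w) (μ n))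
    (v : ℕ → ℝ) (hv : ∀ n, 0 < v n)
    (σsq : ℝ≥0)
    (h_var : Tendsto
      (fun n => v n ^ 2 * variance (RandomJacobi.linStat (a n) (b n) p) (μ n)) atTop
      (𝓝 (σsq : ℝ)))
    (C δ : ℝ) (hC : 0 < C) (hδ : 0 < δ)
    (h_incr : ∀ n, ∀ r ≤ p.natDegree, ∀ w : Fin (r + 1) → Fin n, RandomJacobi.IsAdmissible w →
      ∀ k : ℕ, 1 ≤ k → k ≤ n →
        Integrable (fun ω => RandomJacobi.increment (μ n) (a n) (b n) k
          (RandomJacobi.pathVar (a n) (b n) w) ω ^ 4) (μ n) ∧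
        v n ^ 4 * ∫ ω, RandomJacobi.increment (μ n) (a n) (b n) k
          (RandomJacobi.pathVar (a n) (b n) w) ω ^ 4 ∂(μ n) ≤ C / (n : ℝ) ^ (1 + δ)) :
    TendstoInDistribution
      (fun n ω => v n * (RandomJacobi.linStat (a n) (b n) p ω -
        ∫ ω', RandomJacobi.linStat (a n) (b n) p ω' ∂(μ n)))
      atTop (id : ℝ → ℝ) μ (gaussianReal 0 σsq) := by
  set d := p.natDegree
  have h_path : ∀ n, ∀ q : PathIndex d n, IsAdmissible q.2 →
      Integrable (pathVar (a n) (b n) q.2) (μ n) := fun n q hq =>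
    h_int n q.1 (Nat.lt_succ_iff.1 q.1.isLt) q.2 hq
  have hnear : ∀ n j, ∀ q ∈ pathsNear d n j, IsAdmissible q.2 := by
    intro n j q hq
    simp only [pathsNear, Finset.mem_filter, Finset.mem_univ, true_and] at hq
    exact hq.1
  have hmeas : ∀ n, Measurable (linStat (a n) (b n) p) := fun n =>
    (measurable_linStat (a n) (b n) p).mono ((entryFilt (ha n) (hb n)).le n) le_rfl
  have hincr_meas : ∀ n k (ξ : Ω n → ℝ), StronglyMeasurable[entryFiltration (a n) (b n) (k + 1)]
      (increment (μ n) (a n) (b n) (k + 1) ξ) := fun n k ξ =>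
    stronglyMeasurable_condExp.sub (stronglyMeasurable_condExp.mono
      ((entryFilt (ha n) (hb n)).mono (Nat.le_succ k)))
  -- bounds for the number of paths near an index and for the coefficients of `p`
  set L : ℝ := ((∑ r : Fin (d + 1), (2 * d + 1) ^ ((r : ℕ) + 1) : ℕ) : ℝ)
  set c : ℝ := ∑ r ∈ Finset.range (d + 1), |p.coeff r|
  have hcoeff : ∀ r ≤ d, |p.coeff r| ≤ c := fun r hr =>
    Finset.single_le_sum (f := fun r => |p.coeff r|) (fun _ _ => abs_nonneg _)
      (Finset.mem_range.2 (Nat.lt_succ_of_le hr))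
  refine tendstoInDistribution_of_martingale_differences (M := d)
    (ℱ := fun n => entryFilt (ha n) (hb n))
    (X := fun n j ω => v n * increment (μ n) (a n) (b n) (j + 1) (linStat (a n) (b n) p) ω)
    (β := fun n => L ^ 4 * c ^ 4 * (C / (n : ℝ) ^ (1 + δ)))
    (fun n => (((hmeas n).sub_const _).const_mul _).aemeasurable) (fun n => ae_of_all _ fun ω => ?_)
    (fun n k => (hincr_meas n k _).const_mul _) (fun n j hj => ?_)
    (fun n j _ => condExp_increment_ae_eq_zero (ha n) (hb n) _ _ j)
    (fun n j _ => condExp_increment_linStat_sq (ha n) (hb n) (h_indep n) p (h_path n) j (v n))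
    (fun n j hj => ?_) (fun n => by positivity) ?_ ?_
  · simp only [← Finset.mul_sum, sum_increment_linStat (ha n) (hb n) p (h_path n)]
  · have h := increment_linStat_ae_eq (ha n) (hb n) (h_indep n) p (h_path n) j
    refine MemLp.const_mul (MemLp.ae_eq h.symm (memLp_finsetSum _ fun q hq =>
      MemLp.const_mul ?_ _)) _
    exact memLp_four_of_integrable
      ((hincr_meas n j _).mono ((entryFilt (ha n) (hb n)).le _)).aestronglyMeasurable
      (h_incr n q.1 (Nat.lt_succ_iff.1 q.1.isLt) q.2 (hnear n j q hq) (j + 1) (by omega) hj).1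
  · have h := increment_linStat_ae_eq (ha n) (hb n) (h_indep n) p (h_path n) j
    have hq : ∀ q ∈ pathsNear d n j, _ := fun q hq =>
      h_incr n q.1 (Nat.lt_succ_iff.1 q.1.isLt) q.2 (hnear n j q hq) (j + 1) (by omega) hj
    have hbound := integral_sum_pow_four_le (pathsNear d n j) (fun q => p.coeff q.1)
      (fun q => increment (μ n) (a n) (b n) (j + 1) (pathVar (a n) (b n) q.2))
      (fun q hqm => (hq q hqm).1) (v n) (fun q hqm => (hq q hqm).2)
      (fun q _ => hcoeff q.1 (Nat.lt_succ_iff.1 q.1.isLt))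
    have hcard : ((pathsNear d n j).card : ℝ) ≤ L :=
      Nat.cast_le.2 (card_pathsNear_le d n j)
    calc ∫ ω, (v n * increment (μ n) (a n) (b n) (j + 1) (linStat (a n) (b n) p) ω) ^ 4 ∂(μ n)
        = ∫ ω, (v n * ∑ q ∈ pathsNear d n j, p.coeff q.1 *
            increment (μ n) (a n) (b n) (j + 1) (pathVar (a n) (b n) q.2) ω) ^ 4 ∂(μ n) :=
          integral_congr_ae (h.mono fun ω hω => by
            beta_reduce
            rw [hω])
      _ ≤ _ := hbound
      _ ≤ _ := by gcongr
  · have hlim : Tendsto (fun n : ℕ => L ^ 4 * c ^ 4 * C * ((n : ℝ) ^ (-δ))) atTop (𝓝 0) := by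
      have := ((tendsto_rpow_neg_atTop hδ).comp tendsto_natCast_atTop_atTop).const_mul
        (L ^ 4 * c ^ 4 * C)
      rwa [mul_zero] at this
    refine hlim.congr' ?_
    filter_upwards [eventually_gt_atTop 0] with n hn
    have hn' : (0 : ℝ) < n := by exact_mod_cast hn
    have hpos : (0 : ℝ) < (n : ℝ) ^ δ := Real.rpow_pos_of_pos hn' δ
    rw [Real.rpow_add hn', Real.rpow_one, Real.rpow_neg hn'.le]
    field_simp
  · refine h_var.congr fun n => ?_
    rw [variance_eq_integral (hmeas n).aemeasurable, ← integral_const_mul]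
    simp only [mul_pow]
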